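/- Let $(\mathcal E,\star)$ be a group, let $E\subset\mathcal E$ be a countable subset, and let $(X(t))_{t\ge 0}$ be a substochastic Markov chain on $E$ with transition probabilities $p(x,y)$, $x,y\in E$ (so $\sum_{y\in E}p(x,y)\le 1$; the missing mass leads to an additional absorbing state $\vartheta\notin E$). Put $$G(x,y)=\sum_{t=0}^\infty \mathbb P_x(X(t)=y),\qquad Q(x,y)=\mathbb P_x\bigl(X(t)=y\text{ for some }0<t<\infty\bigr),\qquad x,y\in E,$$ and $G\varphi(x)=\sum_{y\in E}G(x,y)\varphi(y)$ for $\varphi:E\to[0,+\infty]$. Assume that $(X(t))$ is irreducible and transient on $E$ (i.e. $G(x,y)<\infty$ for all $x,y\in E$), and let $u\in E$ be such that $E\star u\subset E$ and $$p(x\star u,y\star u)\ \ge\ p(x,y)\qquad\text{for all }x,y\in E.$$ Assume moreover that the hitting probabilities are slowly varying along $u$, i.e. that $$\lim_{n\to\infty}\frac1n\log Q(x,x\star u^{\star n})=\lim_{n\to\infty}\frac1n\log Q(x\star u^{\star n},x)=0\qquad\text{uniformly in }x\in E,$$ where $u^{\star n}$ is the $n$-th power of $u$ in $\mathcal E$.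 For $\varphi:E\to[0,+\infty)$ let $$A_u\varphi(x)=\sum_{y\in E}a_u(x,y)\varphi(y),\qquad a_u(x,y)=\begin{cases}p(x\star u,y)-p(x,y\star u^{-1})&\text{if }y\in E\star u,\\ p(x\star u,y)&\text{otherwise.}\end{cases}$$ Then every harmonic function of $(X(t))$, that is, every non-zero function $h:E\to[0,+\infty)$ with $\sum_{y\in E}p(x,y)h(y)=h(x)$ for all $x\in E$, satisfies $$h(y\star u)\ =\ h(y)+GA_uh(y)\qquad\text{for all }y\in E.$$ -/

import Mathlib

open MeasureTheory Filter
open scoped ENNReal NNReal BigOperators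

namespace KilledWalk

/-- `p` is a substochastic transition matrix on `S`. -/
def IsSubstochastic {S : Type*} (p : S → S → ℝ≥0) : Prop :=
  ∀ x, ∑' y, (p x y : ℝ≥0∞) ≤ 1

/-- The stochastic matrix on `S ∪ {ϑ}` obtained from a substochastic matrix `p` on `S` by adding
an absorbing state `ϑ`, represented by `none`. -/
noncomputable def extend {S : Type*} (p : S → S → ℝ≥0) : Option S → Option S → ℝ≥0∞
  | some x, some y => p x y
  | some x, none => 1 - ∑' y, (p x y : ℝ≥0∞)
  | none, some _ => 0
  | none, none => 1

/-- `X` is, under the family `(Pr x)` of probability measures, a Markov chain on `S ∪ {ϑ}` with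
transition probabilities `p` on `S`, started at `x` under `Pr x` and stopped at `ϑ`. -/
structure IsMarkovChain {S : Type*} (p : S → S → ℝ≥0) {Ω : Type*} [MeasurableSpace Ω]
    (Pr : S → Measure Ω) (X : ℕ → Ω → Option S) : Prop where
  isProbabilityMeasure : ∀ x, IsProbabilityMeasure (Pr x)
  measurable : ∀ t (s : Set (Option S)), MeasurableSet (X t ⁻¹' s)
  law : ∀ (x : S) (n : ℕ) (c : ℕ → Option S), c 0 = some x →
    Pr x {ω | ∀ i ≤ n, X i ω = c i} = ∏ i ∈ Finset.range n, extend p (c i) (c (i + 1))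

section Chain

variable {S : Type*} {Ω : Type*} [MeasurableSpace Ω]

/-- The Green function `G(x, y) = ∑ₜ ℙₓ(X(t) = y)`. -/
noncomputable def green (Pr : S → Measure Ω) (X : ℕ → Ω → Option S) (x y : S) : ℝ≥0∞ :=
  ∑' t : ℕ, Pr x {ω | X t ω = some y}

/-- The hitting probability `Q(x, y) = ℙₓ(X(t) = y for some 0 < t < ∞)`. -/
noncomputable def hitting (Pr : S → Measure Ω) (X : ℕ → Ω → Option S) (x y : S) : ℝ≥0∞ :=
  Pr x {ω | ∃ t : ℕ, 0 < t ∧ X t ω = some y}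

/-- Irreducibility on `S`. -/
def IsIrreducible (Pr : S → Measure Ω) (X : ℕ → Ω → Option S) : Prop :=
  ∀ x y, ∃ t : ℕ, 0 < Pr x {ω | X t ω = some y}

/-- Transience on `S`. -/
def IsTransient (Pr : S → Measure Ω) (X : ℕ → Ω → Option S) : Prop :=
  ∀ x y, green Pr X x y < ∞

/-- The potential `Gφ(x) = ∑_y G(x, y) φ(y)`. -/
noncomputable def greenOp (Pr : S → Measure Ω) (X : ℕ → Ω → Option S) (φ : S → ℝ≥0∞) (x : S) :
    ℝ≥0∞ :=
  ∑' y, green Pr X x y * φ y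

/-- A non-zero function `h : S → ℝ₊` is harmonic if `P h = h`. -/
def IsHarmonic (p : S → S → ℝ≥0) (h : S → ℝ≥0) : Prop :=
  h ≠ 0 ∧ ∀ x, ∑' y, (p x y : ℝ≥0∞) * h y = h x

end Chain

section Translation

variable {𝓔 : Type*} [Group 𝓔] {E : Set 𝓔} {u : 𝓔}

theorem mul_pow_mem (hu : ∀ x ∈ E, x * u ∈ E) (n : ℕ) : ∀ x ∈ E, x * u ^ n ∈ E := by
  induction n with
  | zero => intro x hx; simpa using hx
  | succ n ih => intro x hx; rw [pow_succ, ← mul_assoc]; exact hu _ (ih x hx)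

/-- `x ⋆ u` as an element of `E`, when `E ⋆ u ⊆ E`. -/
def shift (hu : ∀ x ∈ E, x * u ∈ E) (x : E) : E := ⟨x * u, hu x x.2⟩

/-- `x ⋆ uⁿ` as an element of `E`, when `E ⋆ u ⊆ E`. -/
def shiftPow (hu : ∀ x ∈ E, x * u ∈ E) (n : ℕ) (x : E) : E := ⟨x * u ^ n, mul_pow_mem hu n x x.2⟩

open Classical in
/-- The coefficients `a_u(x, y)`, equal to `p(x ⋆ u, y) - p(x, y ⋆ u⁻¹)` if `y ∈ E ⋆ u` and to
`p(x ⋆ u, y)` otherwise. -/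
noncomputable def coeffA (p : E → E → ℝ≥0) (hu : ∀ x ∈ E, x * u ∈ E) (x y : E) : ℝ :=
  if hy : (y : 𝓔) * u⁻¹ ∈ E then (p (shift hu x) y : ℝ) - p x ⟨y * u⁻¹, hy⟩
  else p (shift hu x) y

/-- The coefficients are non-negative as soon as `p(x ⋆ u, y ⋆ u) ≥ p(x, y)`; the truncation in
the definition of `opA` below is then harmless. -/
theorem coeffA_nonneg (p : E → E → ℝ≥0) (hu : ∀ x ∈ E, x * u ∈ E)
    (hp : ∀ x y : E, p x y ≤ p (shift hu x) (shift hu y)) (x y : E) : 0 ≤ coeffA p hu x y := by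
  unfold coeffA
  split_ifs with hy
  · have h := hp x ⟨y * u⁻¹, hy⟩
    have e : shift hu ⟨y * u⁻¹, hy⟩ = y := Subtype.ext (by simp [shift])
    rw [e] at h
    exact sub_nonneg.2 (by exact_mod_cast h)
  · exact NNReal.coe_nonneg _

/-- The operator `A_u φ(x) = ∑_y a_u(x, y) φ(y)`. -/
noncomputable def opA (p : E → E → ℝ≥0) (hu : ∀ x ∈ E, x * u ∈ E) (φ : E → ℝ≥0∞) (x : E) : ℝ≥0∞ :=
  ∑' y, ENNReal.ofReal (coeffA p hu x y) * φ y

/-- The hitting probabilities are slowly varying along `u`: uniformly in `x ∈ E`,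
`(1/n) log Q(x, x ⋆ uⁿ) → 0` and `(1/n) log Q(x ⋆ uⁿ, x) → 0`. Positivity is stated separately
because the real logarithm takes the value `0`, and not `-∞`, at `0`. -/
def IsSlowlyVarying {Ω : Type*} [MeasurableSpace Ω] (Pr : E → Measure Ω) (X : ℕ → Ω → Option E)
    (hu : ∀ x ∈ E, x * u ∈ E) : Prop :=
  (∀ᶠ n : ℕ in atTop, ∀ x : E,
    0 < hitting Pr X x (shiftPow hu n x) ∧ 0 < hitting Pr X (shiftPow hu n x) x) ∧
  TendstoUniformly
    (fun (n : ℕ) (x : E) => (1 / (n : ℝ)) * Real.log (hitting Pr X x (shiftPow hu n x)).toReal)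
    (fun _ => 0) atTop ∧
  TendstoUniformly
    (fun (n : ℕ) (x : E) => (1 / (n : ℝ)) * Real.log (hitting Pr X (shiftPow hu n x) x).toReal)
    (fun _ => 0) atTop

end Translation

end KilledWalk

/-! For harmonic f, `transOp_shift` gives f(· ⋆ u) = P[f(· ⋆ u)] + A_u f. Hence f(· ⋆ u) is
superharmonic, with Riesz decomposition U f + G A_u f, and the claim is exactly U h = h.

The operator U (`harmonicPartOp`) is linear on the cone of harmonic functions, and Uⁿ f is the
harmonic part of f(· ⋆ uⁿ) (`harmonicPartOp_pow_add`). Since Q(x, y) f(y) ≤ f(x)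
(`IsMarkovChain.hitting_mul_le`), slow variation squeezes f(· ⋆ uⁿ) between aⁿ f and bⁿ f for any 0
< a < 1 < b and all large n, uniformly in f. Harmonic parts inherit these bounds, so aⁿ ≤ Uⁿ ≤ bⁿ on
the cone.

That this forces U = 1 is `apply_eq_of_subexponential`. With T = ∑_{i<n} a^(n-1-i) Uⁱ one has T(U -
a) = Uⁿ - aⁿ ≥ 0. The factor T cannot be cancelled, as its inverse need not be positive, but T lies
between positive multiples of the identity; this lets any bound c ≤ U with c < a be improved
geometrically towards a. The upper bound is symmetric. -/

namespace KilledWalk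

/-! ### Order bounds for linear operators on a cone of functions -/

section Cone

variable {ι : Type*} {M : Submodule ℝ≥0 (ι → ℝ≥0)}

/-- The operator `∑_{i < n} a^(n - 1 - i) Uⁱ`. -/
noncomputable def geomOp (U : Module.End ℝ≥0 M) (a : ℝ≥0) : ℕ → Module.End ℝ≥0 M
  | 0 => 0
  | n + 1 => U * geomOp U a n + a ^ n • 1

theorem geomOp_commute (U : Module.End ℝ≥0 M) (a : ℝ≥0) (n : ℕ) : Commute U (geomOp U a n) := by
  induction n with
  | zero => exact Commute.zero_right _
  | succ n ih =>
    exact ((Commute.refl U).mul_right ih).add_right ((Commute.one_right U).smul_right _)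

/-- Telescoping factorisation of Uⁿ - aⁿ, with negative terms moved across because the scalars are
`ℝ≥0`. -/
theorem geomOp_mul (U : Module.End ℝ≥0 M) (a : ℝ≥0) (n : ℕ) :
    geomOp U a n * U + a ^ n • 1 = U ^ n + a • geomOp U a n := by
  rw [← (geomOp_commute U a n).eq]
  induction n with
  | zero => simp [geomOp]
  | succ n ih =>
    have e : U * geomOp U a (n + 1) + a ^ (n + 1) • (1 : Module.End ℝ≥0 M)
        = U * (U * geomOp U a n + a ^ n • 1) + a ^ (n + 1) • 1 := rfl
    rw [e, ih, geomOp, mul_add, smul_add, pow_succ' U, pow_succ' a, mul_smul, mul_smul_comm,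
      add_assoc]

/-- Linearity gives monotonicity because g - f stays in the cone. -/
theorem apply_mono (hM : ∀ f ∈ M, ∀ g ∈ M, f ≤ g → g - f ∈ M) (U : Module.End ℝ≥0 M) {f g : M}
    (hfg : (f : ι → ℝ≥0) ≤ g) : (U f : ι → ℝ≥0) ≤ U g := by
  have e : g = f + ⟨g - f, hM _ f.2 _ g.2 hfg⟩ :=
    Subtype.ext (by simp [add_tsub_cancel_of_le hfg])
  rw [e, map_add]
  exact le_self_add

theorem le_geomOp (U : Module.End ℝ≥0 M) (a : ℝ≥0) (n : ℕ) (f : M) :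
    ((a ^ n • f : M) : ι → ℝ≥0) ≤ geomOp U a (n + 1) f := by
  simp only [geomOp, LinearMap.add_apply, LinearMap.smul_apply, Module.End.one_apply,
    Submodule.coe_add]
  exact le_add_self

theorem exists_geomOp_le (hM : ∀ f ∈ M, ∀ g ∈ M, f ≤ g → g - f ∈ M) (U : Module.End ℝ≥0 M)
    {C : ℝ≥0} (hC : ∀ f : M, (U f : ι → ℝ≥0) ≤ (C • f : M)) (a : ℝ≥0) (n : ℕ) :
    ∃ K : ℝ≥0, ∀ f : M, (geomOp U a n f : ι → ℝ≥0) ≤ (K • f : M) := by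
  induction n with
  | zero => exact ⟨0, fun f => by simp [geomOp]⟩
  | succ n ih =>
    obtain ⟨K, hK⟩ := ih
    refine ⟨K * C + a ^ n, fun f => ?_⟩
    have h1 : (U (geomOp U a n f) : ι → ℝ≥0) ≤ U (K • f) := apply_mono hM U (hK f)
    have h2 : (U (K • f) : ι → ℝ≥0) ≤ ((K * C) • f : M) := by
      intro x
      rw [map_smul, mul_smul]
      exact mul_le_mul_right (hC f x) K
    simp only [geomOp, LinearMap.add_apply, LinearMap.smul_apply, Module.End.one_apply,
      Submodule.coe_add, Module.End.mul_apply, add_smul]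
    exact add_le_add_left (h1.trans h2) _

theorem geomOp_apply_eq (U : Module.End ℝ≥0 M) (a : ℝ≥0) (n : ℕ) (f : M) (x : ι) :
    ((geomOp U a n (U f)).1 x : ℝ) + a ^ n * f.1 x = ((U ^ n) f).1 x + a * (geomOp U a n f).1 x := by
  have := congrArg (fun V : Module.End ℝ≥0 M => ((V f).1 x : ℝ)) (geomOp_mul U a n)
  simpa using this

/-- If `aⁿ ≤ Uⁿ` on the cone and `U` is bounded, then `a ≤ U`. -/
theorem smul_le_of_pow (hM : ∀ f ∈ M, ∀ g ∈ M, f ≤ g → g - f ∈ M) (U : Module.End ℝ≥0 M)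
    {C : ℝ≥0} (hC : ∀ f : M, (U f : ι → ℝ≥0) ≤ (C • f : M)) {a : ℝ≥0} (ha : 0 < a) {n : ℕ}
    (hn : ∀ f : M, ((a ^ (n + 1) • f : M) : ι → ℝ≥0) ≤ (U ^ (n + 1)) f) (f : M) :
    ((a • f : M) : ι → ℝ≥0) ≤ U f := by
  obtain ⟨K₀, hK₀⟩ := exists_geomOp_le hM U hC a (n + 1)
  -- The extra aⁿ ensures K > 0 and θ ≤ 1 below.
  set K : ℝ≥0 := K₀ + a ^ n with hKdef
  have hK : ∀ f : M, (geomOp U a (n + 1) f : ι → ℝ≥0) ≤ (K • f : M) := fun f =>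
    (hK₀ f).trans (by rw [hKdef, add_smul]; exact le_self_add)
  have hsK : (a : ℝ) ^ n ≤ K := by rw [hKdef]; push_cast; linarith [K₀.2]
  have hs0 : (0 : ℝ) < (a : ℝ) ^ n := by positivity
  have hK0 : (0 : ℝ) < K := hs0.trans_le hsK
  set θ : ℝ := (a : ℝ) ^ n / K with hθ
  have hθ0 : 0 < θ := by positivity
  have hθ1 : θ ≤ 1 := (div_le_one hK0).2 hsK
  -- The constants solve c₀ = 0, c' = c + θ(a - c). For g = U f - c f and T = `geomOp U a (n + 1)`,
  -- the factorisation gives (a - c) aⁿ f ≤ (a - c) T f ≤ T g ≤ K g, so g ≥ (a - c) θ f.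
  have key : ∀ k : ℕ, ∀ (f : M) (x : ι), (a * (1 - (1 - θ) ^ k) : ℝ) * f.1 x ≤ (U f).1 x := by
    intro k
    induction k with
    | zero => intro f x; simp
    | succ k ih =>
      intro f x
      have hc0 : 0 ≤ (a : ℝ) * (1 - (1 - θ) ^ k) :=
        mul_nonneg a.2 (sub_nonneg.2 (pow_le_one₀ (by linarith) (by linarith)))
      obtain ⟨c, hc⟩ : ∃ c : ℝ≥0, (c : ℝ) = a * (1 - (1 - θ) ^ k) := ⟨⟨_, hc0⟩, rfl⟩
      have hca : (c : ℝ) ≤ a := by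
        rw [hc]; nlinarith [a.2, pow_nonneg (show 0 ≤ 1 - θ by linarith) k]
      have hcU : ((c • f : M) : ι → ℝ≥0) ≤ U f := fun z => by
        have := ih f z
        rw [← hc] at this
        exact_mod_cast this
      set g : M := ⟨(U f : ι → ℝ≥0) - (c • f : M), hM _ (c • f).2 _ (U f).2 hcU⟩ with hg
      have hUf : U f = c • f + g :=
        Subtype.ext (by simp only [hg, Submodule.coe_add]; rw [add_tsub_cancel_of_le hcU])
      have e1 : ((U f).1 x : ℝ) = c * f.1 x + g.1 x := by rw [hUf]; simp
      have e2 : ((geomOp U a (n + 1) (U f)).1 x : ℝ)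
          = c * (geomOp U a (n + 1) f).1 x + (geomOp U a (n + 1) g).1 x := by
        rw [hUf, map_add, map_smul]; simp
      have e3 := geomOp_apply_eq U a (n + 1) f x
      have i1 : (a : ℝ) ^ (n + 1) * f.1 x ≤ ((U ^ (n + 1)) f).1 x := by exact_mod_cast hn f x
      have i2 : (a : ℝ) ^ n * f.1 x ≤ (geomOp U a (n + 1) f).1 x := by
        exact_mod_cast le_geomOp U a n f x
      have i3 : ((geomOp U a (n + 1) g).1 x : ℝ) ≤ K * g.1 x := by exact_mod_cast hK g x
      have i4 : ((a : ℝ) - c) * ((a : ℝ) ^ n * f.1 x) ≤ K * g.1 x := by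
        have := mul_le_mul_of_nonneg_left i2 (sub_nonneg.2 hca)
        linarith
      have i5 : ((a : ℝ) - c) * (θ * f.1 x) ≤ g.1 x := by
        have e : ((a : ℝ) - c) * ((a : ℝ) ^ n * f.1 x) = K * (((a : ℝ) - c) * (θ * f.1 x)) := by
          rw [hθ]; field_simp
        rw [e] at i4
        exact le_of_mul_le_mul_left i4 hK0
      rw [e1]
      have e4 : (a * (1 - (1 - θ) ^ (k + 1)) : ℝ) * f.1 x
          = c * f.1 x + ((a : ℝ) - c) * (θ * f.1 x) := by rw [hc]; ring
      linarith
  intro x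
  have hlim : Tendsto (fun k : ℕ => (a * (1 - (1 - θ) ^ k) : ℝ) * f.1 x) atTop
      (nhds ((a * (1 - 0) : ℝ) * f.1 x)) :=
    (((tendsto_pow_atTop_nhds_zero_of_lt_one (by linarith) (by linarith)).const_sub 1).const_mul
      (a : ℝ)).mul_const _
  have := le_of_tendsto' hlim fun k => key k f x
  rw [sub_zero, mul_one] at this
  exact_mod_cast this

/-- If `Uⁿ ≤ bⁿ` on the cone and `U` is bounded, then `U ≤ b`. -/
theorem le_smul_of_pow (hM : ∀ f ∈ M, ∀ g ∈ M, f ≤ g → g - f ∈ M) (U : Module.End ℝ≥0 M)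
    {C : ℝ≥0} (hC : ∀ f : M, (U f : ι → ℝ≥0) ≤ (C • f : M)) {b : ℝ≥0} (hb : 0 < b) {n : ℕ}
    (hn : ∀ f : M, ((U ^ (n + 1)) f : ι → ℝ≥0) ≤ (b ^ (n + 1) • f : M)) (f : M) :
    (U f : ι → ℝ≥0) ≤ (b • f : M) := by
  obtain ⟨K₀, hK₀⟩ := exists_geomOp_le hM U hC b (n + 1)
  set K : ℝ≥0 := K₀ + b ^ n with hKdef
  have hK : ∀ f : M, (geomOp U b (n + 1) f : ι → ℝ≥0) ≤ (K • f : M) := fun f =>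
    (hK₀ f).trans (by rw [hKdef, add_smul]; exact le_self_add)
  have hsK : (b : ℝ) ^ n ≤ K := by rw [hKdef]; push_cast; linarith [K₀.2]
  have hs0 : (0 : ℝ) < (b : ℝ) ^ n := by positivity
  have hK0 : (0 : ℝ) < K := hs0.trans_le hsK
  set θ : ℝ := (b : ℝ) ^ n / K with hθ
  have hθ0 : 0 < θ := by positivity
  have hθ1 : θ ≤ 1 := (div_le_one hK0).2 hsK
  -- Mirror image: start from c₀ = b + C and use g = c f - U f, so that c - b shrinks by the factor
  -- 1 - θ.
  have key : ∀ k : ℕ, ∀ (f : M) (x : ι), ((U f).1 x : ℝ) ≤ (b + C * (1 - θ) ^ k : ℝ) * f.1 x := by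
    intro k
    induction k with
    | zero =>
      intro f x
      have h1 : ((U f).1 x : ℝ) ≤ C * f.1 x := by exact_mod_cast hC f x
      have h2 : (0 : ℝ) ≤ b * f.1 x := mul_nonneg b.2 (f.1 x).2
      rw [pow_zero, mul_one, add_mul]
      linarith
    | succ k ih =>
      intro f x
      have hpk := pow_nonneg (show 0 ≤ 1 - θ by linarith) k
      have hc0 : 0 ≤ (b : ℝ) + C * (1 - θ) ^ k := add_nonneg b.2 (mul_nonneg C.2 hpk)
      obtain ⟨c, hc⟩ : ∃ c : ℝ≥0, (c : ℝ) = b + C * (1 - θ) ^ k := ⟨⟨_, hc0⟩, rfl⟩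
      have hbc : (b : ℝ) ≤ c := by rw [hc]; exact le_add_of_nonneg_right (mul_nonneg C.2 hpk)
      have hcU : (U f : ι → ℝ≥0) ≤ (c • f : M) := fun z => by
        have := ih f z
        rw [← hc] at this
        exact_mod_cast this
      set g : M := ⟨((c • f : M) : ι → ℝ≥0) - U f, hM _ (U f).2 _ (c • f).2 hcU⟩ with hg
      have hUf : c • f = U f + g :=
        Subtype.ext (by simp only [hg, Submodule.coe_add]; rw [add_tsub_cancel_of_le hcU])
      have e1 : (c * f.1 x : ℝ) = (U f).1 x + g.1 x := by
        have := congrArg (fun v : M => (v.1 x : ℝ)) hUf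
        simpa using this
      have e2 : (c * (geomOp U b (n + 1) f).1 x : ℝ)
          = (geomOp U b (n + 1) (U f)).1 x + (geomOp U b (n + 1) g).1 x := by
        have := congrArg (fun v : M => ((geomOp U b (n + 1) v).1 x : ℝ)) hUf
        simpa using this
      have e3 := geomOp_apply_eq U b (n + 1) f x
      have i1 : (((U ^ (n + 1)) f).1 x : ℝ) ≤ (b : ℝ) ^ (n + 1) * f.1 x := by
        exact_mod_cast hn f x
      have i2 : (b : ℝ) ^ n * f.1 x ≤ (geomOp U b (n + 1) f).1 x := by
        exact_mod_cast le_geomOp U b n f x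
      have i3 : ((geomOp U b (n + 1) g).1 x : ℝ) ≤ K * g.1 x := by exact_mod_cast hK g x
      have i4 : ((c : ℝ) - b) * ((b : ℝ) ^ n * f.1 x) ≤ K * g.1 x := by
        have := mul_le_mul_of_nonneg_left i2 (sub_nonneg.2 hbc)
        linarith
      have i5 : ((c : ℝ) - b) * (θ * f.1 x) ≤ g.1 x := by
        have e : ((c : ℝ) - b) * ((b : ℝ) ^ n * f.1 x) = K * (((c : ℝ) - b) * (θ * f.1 x)) := by
          rw [hθ]; field_simp
        rw [e] at i4
        exact le_of_mul_le_mul_left i4 hK0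
      have e4 : (b + C * (1 - θ) ^ (k + 1) : ℝ) * f.1 x
          = c * f.1 x - ((c : ℝ) - b) * (θ * f.1 x) := by rw [hc]; ring
      linarith
  intro x
  have hlim : Tendsto (fun k : ℕ => (b + C * (1 - θ) ^ k : ℝ) * f.1 x) atTop
      (nhds ((b + C * 0 : ℝ) * f.1 x)) :=
    (((tendsto_pow_atTop_nhds_zero_of_lt_one (by linarith) (by linarith)).const_mul
      (C : ℝ)).const_add (b : ℝ)).mul_const _
  have := ge_of_tendsto' hlim fun k => key k f x
  rw [mul_zero, add_zero] at this
  exact_mod_cast this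

/-- A linear operator on a cone of non-negative functions whose powers are bounded above and below
by subexponential multiples of the identity is the identity. -/
theorem apply_eq_of_subexponential (hM : ∀ f ∈ M, ∀ g ∈ M, f ≤ g → g - f ∈ M)
    (U : Module.End ℝ≥0 M)
    (hU : ∀ a b : ℝ≥0, 0 < a → a < 1 → 1 < b → ∀ᶠ n : ℕ in atTop, ∀ f : M,
      ((a ^ n • f : M) : ι → ℝ≥0) ≤ (U ^ n) f ∧ ((U ^ n) f : ι → ℝ≥0) ≤ (b ^ n • f : M))
    (f : M) : U f = f := by
  obtain ⟨C, hC⟩ : ∃ C : ℝ≥0, ∀ f : M, (U f : ι → ℝ≥0) ≤ (C • f : M) := by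
    obtain ⟨N, hN⟩ := eventually_atTop.1 (hU (1 / 2) 2 (by norm_num)
      (by rw [← NNReal.coe_lt_coe]; norm_num) (by norm_num))
    -- Two consecutive powers bound U: applying U to 2⁻ᴺ f ≤ Uᴺ f gives 2⁻ᴺ U f ≤ Uᴺ⁺¹ f ≤ 2ᴺ⁺¹ f.
    refine ⟨((1 / 2) ^ N)⁻¹ * 2 ^ (N + 1), fun f x => ?_⟩
    have h1 := apply_mono hM U (hN N le_rfl f).1 x
    have h2 := (hN (N + 1) (by omega) f).2 x
    rw [pow_succ' U, Module.End.mul_apply] at h2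
    have h3 := h1.trans h2
    rw [map_smul] at h3
    change (1 / 2 : ℝ≥0) ^ N * (U f).1 x ≤ 2 ^ (N + 1) * f.1 x at h3
    change (U f).1 x ≤ (((1 / 2) ^ N)⁻¹ * 2 ^ (N + 1)) * f.1 x
    rw [mul_assoc]
    exact (le_inv_mul_iff₀ (by positivity)).2 h3
  refine Subtype.ext (funext fun x => le_antisymm ?_ ?_)
  · have hb : ∀ b : ℝ≥0, 1 < b → (U f).1 x ≤ b * f.1 x := by
      intro b hb
      obtain ⟨N, hN⟩ := eventually_atTop.1 (hU (1 / 2) b (by norm_num)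
        (by rw [← NNReal.coe_lt_coe]; norm_num) hb)
      exact le_smul_of_pow hM U hC (zero_lt_one.trans hb)
        (fun g => (hN (N + 1) (by omega) g).2) f x
    have hlim : Tendsto (fun b : ℝ≥0 => b * f.1 x) (nhdsWithin 1 (Set.Ioi 1))
        (nhds (1 * f.1 x)) :=
      ((continuous_id.mul continuous_const).tendsto _).mono_left nhdsWithin_le_nhds
    rw [one_mul] at hlim
    exact ge_of_tendsto hlim (eventually_nhdsWithin_of_forall hb)
  · have ha : ∀ a ∈ Set.Ioo (0 : ℝ≥0) 1, a * f.1 x ≤ (U f).1 x := by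
      rintro a ⟨ha0, ha1⟩
      obtain ⟨N, hN⟩ := eventually_atTop.1 (hU a 2 ha0 ha1 (by norm_num))
      exact smul_le_of_pow hM U hC ha0 (fun g => (hN (N + 1) (by omega) g).1) f x
    have hlim : Tendsto (fun a : ℝ≥0 => a * f.1 x) (nhdsWithin 1 (Set.Iio 1))
        (nhds (1 * f.1 x)) :=
      ((continuous_id.mul continuous_const).tendsto _).mono_left nhdsWithin_le_nhds
    rw [one_mul] at hlim
    have : Set.Ioo (0 : ℝ≥0) 1 ∈ nhdsWithin 1 (Set.Iio 1) := Ioo_mem_nhdsLT zero_lt_one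
    have hne : (nhdsWithin (1 : ℝ≥0) (Set.Iio 1)).NeBot :=
      nhdsLT_neBot_of_exists_lt ⟨0, zero_lt_one⟩
    exact le_of_tendsto hlim (Filter.mem_of_superset this ha)

end Cone

/-! ### Markov property and hitting probabilities -/

section Markov

variable {S : Type*} {Ω : Type*} [MeasurableSpace Ω] {p : S → S → ℝ≥0} {Pr : S → Measure Ω}
  {X : ℕ → Ω → Option S}

/-- The transition operator `P`. -/
noncomputable def transOp (p : S → S → ℝ≥0) (f : S → ℝ≥0∞) (x : S) : ℝ≥0∞ :=
  ∑' y, (p x y : ℝ≥0∞) * f y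

theorem IsMarkovChain.measurableSet_eq (hX : IsMarkovChain p Pr X) (t : ℕ) (a : Option S) :
    MeasurableSet {ω | X t ω = a} := hX.measurable t {a}

theorem IsMarkovChain.ae_zero (hX : IsMarkovChain p Pr X) (x : S) :
    ∀ᵐ ω ∂Pr x, X 0 ω = some x := by
  have := hX.isProbabilityMeasure x
  have h := hX.law x 0 (fun _ => some x) rfl
  rw [Finset.range_zero, Finset.prod_empty] at h
  have e : {ω | ∀ i ≤ 0, X i ω = some x} = {ω | X 0 ω = some x} := by ext; simp
  rw [e] at h
  rw [ae_iff, ← Set.compl_ofPred, prob_compl_eq_zero_iff (hX.measurableSet_eq 0 _)]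
  exact h

/-- Countably many null cylinders of length n + 1 cover the event. -/
theorem measure_path_eq_zero [Countable S] (x : S) (n : ℕ) (B : Set (ℕ → Option S))
    (hB : ∀ c ∈ B, Pr x {ω | ∀ i ≤ n, X i ω = c i} = 0) :
    Pr x {ω | (fun i => X i ω) ∈ B} = 0 := by
  have hsub : {ω | (fun i => X i ω) ∈ B} ⊆
      ⋃ d : ((fun (c : ℕ → Option S) (i : Fin (n + 1)) => c i) '' B),
        {ω | ∀ i : Fin (n + 1), X i ω = d.1 i} := fun ω hω =>
    Set.mem_iUnion.2 ⟨⟨_, _, hω, rfl⟩, fun _ => rfl⟩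
  refine measure_mono_null hsub (measure_iUnion_null ?_)
  rintro ⟨_, c, hc, rfl⟩
  rw [← hB c hc]
  congr 1
  ext ω
  exact ⟨fun h i hi => h ⟨i, Nat.lt_succ_of_le hi⟩, fun h i => h i (Nat.le_of_lt_succ i.2)⟩

/-- The cemetery is absorbing. -/
theorem IsMarkovChain.ae_absorbing [Countable S] (hX : IsMarkovChain p Pr X) (x : S) :
    ∀ᵐ ω ∂Pr x, ∀ t, X t ω = none → X (t + 1) ω = none := by
  rw [ae_all_iff]
  intro t
  have h0 : Pr x {ω | (fun i => X i ω) ∈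
      {c : ℕ → Option S | c 0 = some x ∧ c t = none ∧ c (t + 1) ≠ none}} = 0 := by
    refine measure_path_eq_zero x (t + 1) _ ?_
    rintro c ⟨hc0, hct, hct'⟩
    rw [hX.law x (t + 1) c hc0]
    refine Finset.prod_eq_zero (Finset.self_mem_range_succ t) ?_
    obtain ⟨y, hy⟩ := Option.ne_none_iff_exists'.1 hct'
    rw [hct, hy]
    rfl
  have h1 : ∀ᵐ ω ∂Pr x, ¬ (X 0 ω = some x ∧ X t ω = none ∧ X (t + 1) ω ≠ none) := by
    rw [ae_iff]
    simpa using h0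
  filter_upwards [h1, hX.ae_zero x] with ω h1 h2 h3
  by_contra h4
  exact h1 ⟨h2, h3, h4⟩

theorem IsMarkovChain.measurable_path [Countable S] (hX : IsMarkovChain p Pr X) (n k : ℕ) :
    @Measurable Ω (Fin (n + 1) → Option S) _ ⊤ fun ω i => X (i + k) ω := by
  let _ : MeasurableSpace (Fin (n + 1) → Option S) := ⊤
  refine measurable_to_countable' fun c => ?_
  have e : (fun (ω : Ω) (i : Fin (n + 1)) => X (i + k) ω) ⁻¹' {c} =
      ⋂ i : Fin (n + 1), {ω | X (i + k) ω = c i} := by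
    ext ω
    simp [funext_iff]
  rw [e]
  exact MeasurableSet.iInter fun i => hX.measurableSet_eq _ _

/-- The Markov property at time one. -/
theorem IsMarkovChain.first_step [Countable S] (hX : IsMarkovChain p Pr X) (x z : S)
    (n : ℕ) (B : Set (Fin (n + 1) → Option S)) :
    Pr x {ω | X 1 ω = some z ∧ (fun i : Fin (n + 1) => X (i + 1) ω) ∈ B} =
      p x z * Pr z {ω | (fun i : Fin (n + 1) => X i ω) ∈ B} := by
  let _ : MeasurableSpace (Fin (n + 1) → Option S) := ⊤
  have hm := hX.measurable_path n
  have hB : MeasurableSet B := trivial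
  -- On a countable path space it suffices to compare singletons, where `law` applies to the path c
  -- and to c preceded by x.
  have key : ((Pr x).restrict {ω | X 1 ω = some z}).map
        (fun (ω : Ω) (i : Fin (n + 1)) => X (i + 1) ω) =
      (p x z : ℝ≥0∞) • (Pr z).map (fun (ω : Ω) (i : Fin (n + 1)) => X (i + 0) ω) := by
    refine Measure.ext_of_singleton fun c => ?_
    rw [Measure.smul_apply, Measure.map_apply (hm 1) trivial, Measure.map_apply (hm 0) trivial,
      Measure.restrict_apply (hm 1 trivial), smul_eq_mul]
    set d : ℕ → Option S := fun i => if hi : i < n + 1 then c ⟨i, hi⟩ else none with hd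
    have hdc : ∀ i : Fin (n + 1), d i = c i := fun i => dif_pos i.2
    have hcd : ∀ (k : ℕ) (ω : Ω), (fun i : Fin (n + 1) => X (i + k) ω) = c ↔
        ∀ i ≤ n, X (i + k) ω = d i := by
      intro k ω
      rw [funext_iff]
      refine ⟨fun h i hi => ?_, fun h i => ?_⟩
      · have := h ⟨i, Nat.lt_succ_of_le hi⟩
        rwa [← hdc] at this
      · rw [h i (Nat.le_of_lt_succ i.2), hdc]
    by_cases hc : d 0 = some z
    · have e2 : (fun (ω : Ω) (i : Fin (n + 1)) => X (i + 0) ω) ⁻¹' {c} =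
          {ω | ∀ i ≤ n, X i ω = d i} := Set.ext fun ω => hcd 0 ω
      set d' : ℕ → Option S := fun i => Nat.casesOn i (some x) d with hd'
      have e1 : Pr x ((fun (ω : Ω) (i : Fin (n + 1)) => X (i + 1) ω) ⁻¹' {c} ∩
          {ω | X 1 ω = some z}) = Pr x {ω | ∀ i ≤ n + 1, X i ω = d' i} := by
        refine measure_congr ?_
        filter_upwards [hX.ae_zero x] with ω h0
        refine propext ⟨fun h i hi => ?_, fun h => ⟨(hcd 1 ω).2 fun i hi => ?_, ?_⟩⟩
        · cases i with
          | zero => exact h0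
          | succ i => exact (hcd 1 ω).1 h.1 i (by omega)
        · exact h (i + 1) (by omega)
        · exact (h 1 (by omega)).trans hc
      rw [e1, e2, hX.law x (n + 1) d' rfl, hX.law z n d hc, Finset.prod_range_succ', mul_comm]
      have e3 : extend p (d' 0) (d' (0 + 1)) = p x z := by
        change extend p (some x) (d 0) = p x z
        rw [hc]
        rfl
      rw [e3]
    · have e1 : (fun (ω : Ω) (i : Fin (n + 1)) => X (i + 1) ω) ⁻¹' {c} ∩
          {ω | X 1 ω = some z} = ∅ := by
        refine Set.eq_empty_of_forall_notMem fun ω h => hc ?_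
        rw [← (hcd 1 ω).1 h.1 0 (Nat.zero_le _)]
        exact h.2
      have e2 : Pr z ((fun (ω : Ω) (i : Fin (n + 1)) => X (i + 0) ω) ⁻¹' {c}) = 0 := by
        refine measure_mono_null (fun ω h => ?_) (ae_iff.1 (hX.ae_zero z))
        have := (hcd 0 ω).1 h 0 (Nat.zero_le _)
        exact fun h0 => hc (this.symm.trans h0)
      rw [e1, e2, measure_empty, mul_zero]
  have := congrArg (fun μ => μ B) key
  simp only [Measure.smul_apply, smul_eq_mul] at this
  rw [Measure.map_apply (hm 1) hB, Measure.map_apply (hm 0) hB,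
    Measure.restrict_apply (hm 1 hB)] at this
  rw [Set.inter_comm] at this
  exact this

/-- Decomposition of an event according to the first step. -/
theorem IsMarkovChain.measure_eq_tsum [Countable S] (hX : IsMarkovChain p Pr X) (x : S)
    {n : ℕ} (B : Set (Fin (n + 1) → Option S)) (hB : ∀ c ∈ B, ∃ i, c i ≠ none) :
    Pr x {ω | (fun i : Fin (n + 1) => X (i + 1) ω) ∈ B} =
      transOp p (fun z => Pr z {ω | (fun i : Fin (n + 1) => X i ω) ∈ B}) x := by
  have hmeas : MeasurableSet {ω | (fun i : Fin (n + 1) => X (i + 1) ω) ∈ B} :=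
    hX.measurable_path n 1 (t := B) trivial
  have e : Pr x {ω | (fun i : Fin (n + 1) => X (i + 1) ω) ∈ B} =
      Pr x (⋃ z : S, {ω | X 1 ω = some z ∧ (fun i : Fin (n + 1) => X (i + 1) ω) ∈ B}) := by
    refine measure_congr ?_
    filter_upwards [hX.ae_absorbing x] with ω hω
    refine propext ⟨fun h => ?_, fun h => ?_⟩
    -- A path in ϑ at time 1 stays there, which `hB` excludes.
    · have h1 : X 1 ω ≠ none := by
        intro h1
        have hall : ∀ t, X (t + 1) ω = none := fun t => by
          induction t with
          | zero => exact h1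
          | succ t ih => exact hω _ ih
        obtain ⟨i, hi⟩ := hB _ h
        exact hi (hall i)
      obtain ⟨z, hz⟩ := Option.ne_none_iff_exists'.1 h1
      exact Set.mem_iUnion.2 ⟨z, hz, h⟩
    · obtain ⟨z, -, hz⟩ := Set.mem_iUnion.1 h
      exact hz
  rw [e, measure_iUnion]
  · exact tsum_congr fun z => hX.first_step x z n B
  · intro z w hzw
    refine Set.disjoint_left.2 fun ω h1 h2 => hzw ?_
    exact Option.some_injective _ (h1.1.symm.trans h2.1)
  · exact fun z => (hX.measurableSet_eq 1 (some z)).inter hmeas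

theorem IsMarkovChain.occupation_succ [Countable S] (hX : IsMarkovChain p Pr X) (x y : S)
    (t : ℕ) :
    Pr x {ω | X (t + 1) ω = some y} = transOp p (fun z => Pr z {ω | X t ω = some y}) x :=
  hX.measure_eq_tsum x {c : Fin (t + 1) → Option S | c (Fin.last t) = some y}
    fun c hc => ⟨Fin.last t, by
      rw [show c (Fin.last t) = some y from hc]; exact Option.some_ne_none y⟩

theorem transOp_mono (p : S → S → ℝ≥0) : Monotone (transOp p) := fun _ _ h _ =>
  ENNReal.tsum_le_tsum fun y => mul_le_mul_right (h y) _

/-- A harmonic function `h` satisfies `Q(x, y) h(y) ≤ h(x)`. -/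
theorem IsMarkovChain.hitting_mul_le [Countable S] (hX : IsMarkovChain p Pr X) {h : S → ℝ≥0∞}
    (hh : transOp p h = h) (x y : S) : hitting Pr X x y * h y ≤ h x := by
  have hpr := hX.isProbabilityMeasure
  -- Induction on the horizon: after a first step to z, either z = y and the probability is at most
  -- 1, or n steps remain from z.
  have key : ∀ (n : ℕ) (x : S), Pr x {ω | ∃ i : Fin n, X (i + 1) ω = some y} * h y ≤ h x := by
    intro n
    induction n with
    | zero => intro x; simp
    | succ n ih =>
      intro x
      have e := hX.measure_eq_tsum x {c : Fin (n + 1) → Option S | ∃ i, c i = some y}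
        fun c ⟨i, hi⟩ => ⟨i, by rw [hi]; exact Option.some_ne_none y⟩
      refine (congrArg (· * h y) e).trans_le ?_
      calc _ = transOp p (fun z =>
            Pr z {ω | ∃ i : Fin (n + 1), X i ω = some y} * h y) x := by
            simp only [transOp, ← ENNReal.tsum_mul_right, mul_assoc]
            rfl
        _ ≤ transOp p h x := transOp_mono p (fun z => ?_) x
        _ = h x := congrFun hh x
      by_cases hz : z = y
      · subst hz
        exact (mul_le_mul_left prob_le_one _).trans_eq (one_mul _)
      · refine (mul_le_mul_left (measure_mono_ae ?_) _).trans (ih z)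
        filter_upwards [hX.ae_zero z] with ω h0
        rintro ⟨i, hi⟩
        induction i using Fin.cases with
        | zero => exact absurd (Option.some_injective _ (h0.symm.trans hi)) hz
        | succ j => exact ⟨j, by simpa using hi⟩
  have e : {ω | ∃ t : ℕ, 0 < t ∧ X t ω = some y} =
      ⋃ n : ℕ, {ω | ∃ i : Fin n, X (i + 1) ω = some y} := by
    ext ω
    simp only [Set.mem_iUnion]
    constructor
    · rintro ⟨t, ht, h⟩
      exact ⟨t, ⟨t - 1, by omega⟩, by simpa [Nat.sub_add_cancel ht] using h⟩
    · rintro ⟨n, i, h⟩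
      exact ⟨i + 1, Nat.succ_pos _, h⟩
  have hmono : Monotone fun n : ℕ => {ω | ∃ i : Fin n, X (i + 1) ω = some y} :=
    fun m n hmn ω ⟨i, hi⟩ => ⟨Fin.castLE hmn i, hi⟩
  rw [hitting, e, hmono.measure_iUnion, ENNReal.iSup_mul]
  exact iSup_le fun n => key n x

end Markov

/-! ### Potentials and the cone of harmonic functions -/

section Potential

variable {S : Type*} {Ω : Type*} [MeasurableSpace Ω] {p : S → S → ℝ≥0} {Pr : S → Measure Ω}
  {X : ℕ → Ω → Option S}

theorem transOp_add (p : S → S → ℝ≥0) (f g : S → ℝ≥0∞) :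
    transOp p (f + g) = transOp p f + transOp p g := by
  funext x
  simp only [transOp, Pi.add_apply, mul_add, ENNReal.tsum_add]

theorem transOp_const_mul (p : S → S → ℝ≥0) (c : ℝ≥0∞) (f : S → ℝ≥0∞) :
    transOp p (fun x => c * f x) = fun x => c * transOp p f x := by
  funext x
  simp only [transOp, ← ENNReal.tsum_mul_left, mul_left_comm]

theorem transOp_tsum (p : S → S → ℝ≥0) {ι : Type*} (f : ι → S → ℝ≥0∞) :
    transOp p (fun x => ∑' i, f i x) = fun x => ∑' i, transOp p (f i) x := by
  funext x
  simp only [transOp, ← ENNReal.tsum_mul_left]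
  exact ENNReal.tsum_comm

theorem iterate_transOp_add (p : S → S → ℝ≥0) (n : ℕ) (f g : S → ℝ≥0∞) :
    (transOp p)^[n] (f + g) = (transOp p)^[n] f + (transOp p)^[n] g := by
  induction n generalizing f g with
  | zero => rfl
  | succ n ih => simp only [Function.iterate_succ_apply, transOp_add, ih]

theorem greenOp_add (φ ψ : S → ℝ≥0∞) :
    greenOp Pr X (φ + ψ) = greenOp Pr X φ + greenOp Pr X ψ := by
  funext x
  simp only [greenOp, Pi.add_apply, mul_add, ENNReal.tsum_add]

theorem greenOp_const_mul (c : ℝ≥0∞) (φ : S → ℝ≥0∞) :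
    greenOp Pr X (fun x => c * φ x) = fun x => c * greenOp Pr X φ x := by
  funext x
  simp only [greenOp, ← ENNReal.tsum_mul_left, mul_left_comm]

theorem IsMarkovChain.iterate_transOp [Countable S] (hX : IsMarkovChain p Pr X) (t : ℕ)
    (φ : S → ℝ≥0∞) (x : S) :
    (transOp p)^[t] φ x = ∑' y, Pr x {ω | X t ω = some y} * φ y := by
  induction t generalizing x with
  | zero =>
    have hpr := hX.isProbabilityMeasure x
    rw [tsum_eq_single x]
    · have : Pr x {ω | X 0 ω = some x} = 1 :=
        (prob_compl_eq_zero_iff (hX.measurableSet_eq 0 _)).1 (hX.ae_zero x)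
      rw [this, one_mul]
      rfl
    · intro y hy
      have : Pr x {ω | X 0 ω = some y} = 0 := by
        refine measure_mono_null (fun ω (h : _ = _) => ?_) (ae_iff.1 (hX.ae_zero x))
        exact fun h0 => hy (Option.some_injective _ (h.symm.trans h0))
      rw [this, zero_mul]
  | succ t ih =>
    rw [Function.iterate_succ_apply', funext ih, transOp_tsum]
    refine tsum_congr fun y => ?_
    rw [hX.occupation_succ]
    simp only [transOp, ← ENNReal.tsum_mul_right, mul_assoc]

theorem IsMarkovChain.greenOp_eq_tsum [Countable S] (hX : IsMarkovChain p Pr X)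
    (φ : S → ℝ≥0∞) (x : S) : greenOp Pr X φ x = ∑' t, (transOp p)^[t] φ x := by
  simp only [greenOp, green, hX.iterate_transOp, ← ENNReal.tsum_mul_right]
  exact ENNReal.tsum_comm

theorem IsMarkovChain.iterate_transOp_greenOp [Countable S] (hX : IsMarkovChain p Pr X)
    (φ : S → ℝ≥0∞) (n : ℕ) (x : S) :
    (transOp p)^[n] (greenOp Pr X φ) x = ∑' t, (transOp p)^[t + n] φ x := by
  induction n generalizing x with
  | zero => exact hX.greenOp_eq_tsum φ x
  | succ n ih =>
    rw [Function.iterate_succ_apply', funext ih, transOp_tsum]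
    exact tsum_congr fun t => by rw [← Function.iterate_succ_apply' (transOp p)]; rfl

theorem IsMarkovChain.greenOp_eq_add [Countable S] (hX : IsMarkovChain p Pr X)
    (φ : S → ℝ≥0∞) (x : S) : greenOp Pr X φ x = φ x + transOp p (greenOp Pr X φ) x := by
  rw [hX.greenOp_eq_tsum, tsum_eq_zero_add' ENNReal.summable]
  congr 1
  exact (hX.iterate_transOp_greenOp φ 1 x).symm

/-- A solution of `f = P f + φ` dominates `G φ`. -/
theorem IsMarkovChain.greenOp_le [Countable S] (hX : IsMarkovChain p Pr X) {f φ : S → ℝ≥0∞}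
    (hf : f = transOp p f + φ) : greenOp Pr X φ ≤ f := by
  intro x
  have key : ∀ n : ℕ, f = (transOp p)^[n] f + ∑ t ∈ Finset.range n, (transOp p)^[t] φ := by
    intro n
    induction n with
    | zero => simp
    | succ n ih =>
      have e : (transOp p)^[n] f = (transOp p)^[n + 1] f + (transOp p)^[n] φ := by
        conv_lhs => rw [hf]
        rw [iterate_transOp_add, Function.iterate_succ_apply]
      rw [Finset.sum_range_succ, add_comm (∑ t ∈ Finset.range n, _), ← add_assoc, ← e]
      exact ih
  rw [hX.greenOp_eq_tsum, ENNReal.tsum_eq_iSup_nat]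
  refine iSup_le fun n => ?_
  have := congrFun (key n) x
  rw [this, Pi.add_apply, Finset.sum_apply]
  exact le_add_self

/-- `Pⁿ g → 0` pointwise. -/
def IsVanishing (p : S → S → ℝ≥0) (g : S → ℝ≥0∞) : Prop :=
  ∀ x, Tendsto (fun n => (transOp p)^[n] g x) atTop (nhds 0)

theorem IsVanishing.add {f g : S → ℝ≥0∞} (hf : IsVanishing p f) (hg : IsVanishing p g) :
    IsVanishing p (f + g) := fun x => by
  have := (hf x).add (hg x)
  rw [add_zero] at this
  exact this.congr fun n => by rw [iterate_transOp_add]; rfl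

/-- Pⁿ G φ is the tail of the convergent series ∑ Pᵗ φ. -/
theorem IsMarkovChain.isVanishing_greenOp [Countable S] (hX : IsMarkovChain p Pr X)
    {φ : S → ℝ≥0∞} (hφ : ∀ x, greenOp Pr X φ x ≠ ∞) : IsVanishing p (greenOp Pr X φ) := by
  intro x
  have h := hφ x
  rw [hX.greenOp_eq_tsum] at h
  exact (ENNReal.tendsto_sum_nat_add _ h).congr fun n => (hX.iterate_transOp_greenOp φ n x).symm

/-- The cone of non-negative functions `h` with `P h = h`. -/
noncomputable def harmonicCone (p : S → S → ℝ≥0) : Submodule ℝ≥0 (S → ℝ≥0) where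
  carrier := {h | transOp p (fun x => (h x : ℝ≥0∞)) = fun x => (h x : ℝ≥0∞)}
  zero_mem' := by
    funext x
    simp [transOp]
  add_mem' {f g} hf hg := by
    have := transOp_add p (fun x => (f x : ℝ≥0∞)) (fun x => (g x : ℝ≥0∞))
    rw [show transOp p _ = _ from hf, show transOp p _ = _ from hg] at this
    simpa [Pi.add_def] using this
  smul_mem' c f hf := by
    have := transOp_const_mul p c (fun x => (f x : ℝ≥0∞))
    rw [show transOp p _ = _ from hf] at this
    simpa using this

theorem harmonicCone_sub (p : S → S → ℝ≥0) (f : S → ℝ≥0) (hf : f ∈ harmonicCone p)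
    (g : S → ℝ≥0) (hg : g ∈ harmonicCone p) (hfg : f ≤ g) : g - f ∈ harmonicCone p := by
  have e : (fun x => (g x : ℝ≥0∞)) =
      (fun x => (f x : ℝ≥0∞)) + fun x => ((g - f) x : ℝ≥0∞) := by
    funext x
    rw [Pi.add_apply, ← ENNReal.coe_add, Pi.sub_apply, add_tsub_cancel_of_le (hfg x)]
  have h := transOp_add p (fun x => (f x : ℝ≥0∞)) (fun x => ((g - f) x : ℝ≥0∞))
  rw [← e, show transOp p _ = _ from hg, show transOp p _ = _ from hf, e] at h
  funext x
  exact ((ENNReal.add_right_inj ENNReal.coe_ne_top).1 (congrFun h x)).symm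

theorem iterate_transOp_harmonic (f : harmonicCone p) (m : ℕ) :
    (transOp p)^[m] (fun x => (f.1 x : ℝ≥0∞)) = fun x => (f.1 x : ℝ≥0∞) :=
  Function.iterate_fixed f.2 m

end Potential

/-! ### Translation by u and Riesz decomposition -/

section Translate

variable {𝓔 : Type*} [Group 𝓔] {E : Set 𝓔} {u : 𝓔} {p : E → E → ℝ≥0}
  {Ω : Type*} [MeasurableSpace Ω] {Pr : E → Measure Ω} {X : ℕ → Ω → Option E}
  {hu : ∀ x ∈ E, x * u ∈ E}

theorem shift_injective (hu : ∀ x ∈ E, x * u ∈ E) : Function.Injective (shift hu) :=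
  fun _ _ h => Subtype.ext (mul_right_cancel (congrArg Subtype.val h))

theorem shiftPow_shift (n : ℕ) (x : E) : shiftPow hu (n + 1) x = shiftPow hu n (shift hu x) :=
  Subtype.ext (by simp [shift, shiftPow, pow_succ', mul_assoc])

theorem transOp_comp_shift_le (hp : ∀ x y : E, p x y ≤ p (shift hu x) (shift hu y))
    (g : E → ℝ≥0∞) (x : E) :
    transOp p (fun y => g (shift hu y)) x ≤ transOp p g (shift hu x) := by
  refine (ENNReal.tsum_le_tsum fun y => ?_).trans
    (ENNReal.tsum_comp_le_tsum_of_injective (shift_injective hu)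
      fun w => (p (shift hu x) w : ℝ≥0∞) * g w)
  exact mul_le_mul_left (ENNReal.coe_le_coe.2 (hp x y)) _

/-- The inequality on p lets iterates of P commute with the translation up to ≤, so the limit 0 is
inherited by squeezing. -/
theorem IsVanishing.comp_shift (hp : ∀ x y : E, p x y ≤ p (shift hu x) (shift hu y))
    {g : E → ℝ≥0∞} (hg : IsVanishing p g) : IsVanishing p fun y => g (shift hu y) := by
  have key : ∀ (n : ℕ) (x : E),
      (transOp p)^[n] (fun y => g (shift hu y)) x ≤ (transOp p)^[n] g (shift hu x) := by
    intro n
    induction n with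
    | zero => exact fun x => le_rfl
    | succ n ih =>
      intro x
      rw [Function.iterate_succ_apply', Function.iterate_succ_apply']
      exact (transOp_mono p ih x).trans (transOp_comp_shift_le hp _ x)
  exact fun x => tendsto_of_tendsto_of_tendsto_of_le_of_le tendsto_const_nhds (hg (shift hu x))
    (fun _ => zero_le) fun n => key n x

/-- `P φ (x ⋆ u) = P (φ(· ⋆ u)) (x) + A_u φ (x)`. -/
theorem transOp_shift (hp : ∀ x y : E, p x y ≤ p (shift hu x) (shift hu y)) (φ : E → ℝ≥0∞)
    (x : E) :
    transOp p φ (shift hu x) = transOp p (fun y => φ (shift hu y)) x + opA p hu φ x := by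
  classical
  -- This is p(x, · ⋆ u⁻¹) extended by 0 off E ⋆ u, so that a_u(x, ·) = p(x ⋆ u, ·) - q in both
  -- cases.
  set q : E → ℝ≥0 := fun w => if hw : (w : 𝓔) * u⁻¹ ∈ E then p x ⟨w * u⁻¹, hw⟩ else 0 with hq
  have hqs : ∀ y, q (shift hu y) = p x y := by
    intro y
    have e : ((shift hu y : E) : 𝓔) * u⁻¹ = y := by simp [shift]
    simp only [hq, e, y.2, dif_pos, Subtype.coe_eta]
  have hsupp : Function.support (fun w => (q w : ℝ≥0∞) * φ w) ⊆ Set.range (shift hu) := by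
    intro w hw
    by_cases h : (w : 𝓔) * u⁻¹ ∈ E
    · exact ⟨⟨_, h⟩, Subtype.ext (by simp [shift])⟩
    · exact absurd (by simp [hq, h]) hw
  have e1 : transOp p (fun y => φ (shift hu y)) x = ∑' w, (q w : ℝ≥0∞) * φ w := by
    rw [← (shift_injective hu).tsum_eq hsupp]
    exact tsum_congr fun y => by rw [hqs]
  have e2 : ∀ w, (p (shift hu x) w : ℝ≥0∞) = q w + ENNReal.ofReal (coeffA p hu x w) := by
    intro w
    rw [← ENNReal.ofReal_coe_nnreal (p := q w),
      ← ENNReal.ofReal_add (NNReal.coe_nonneg _) (coeffA_nonneg p hu hp x w), ← ENNReal.ofReal_coe_nnreal]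
    congr 1
    by_cases h : (w : 𝓔) * u⁻¹ ∈ E <;> simp [hq, coeffA, h]
  rw [e1, opA, ← ENNReal.tsum_add]
  exact tsum_congr fun w => by rw [e2, add_mul]

theorem comp_shift_eq (hp : ∀ x y : E, p x y ≤ p (shift hu x) (shift hu y))
    (f : harmonicCone p) :
    (fun x => (f.1 (shift hu x) : ℝ≥0∞)) =
      transOp p (fun x => (f.1 (shift hu x) : ℝ≥0∞)) + opA p hu fun x => (f.1 x : ℝ≥0∞) := by
  funext x
  rw [Pi.add_apply, ← transOp_shift hp (fun x => (f.1 x : ℝ≥0∞))]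
  exact (congrFun f.2 (shift hu x)).symm

theorem opA_add (φ ψ : E → ℝ≥0∞) : opA p hu (φ + ψ) = opA p hu φ + opA p hu ψ := by
  funext x
  simp only [opA, Pi.add_apply, mul_add, ENNReal.tsum_add]

theorem opA_const_mul (c : ℝ≥0∞) (φ : E → ℝ≥0∞) :
    opA p hu (fun x => c * φ x) = fun x => c * opA p hu φ x := by
  funext x
  simp only [opA, ← ENNReal.tsum_mul_left, mul_left_comm]

/-- The harmonic part of `f(· ⋆ u)` in its Riesz decomposition, as a function. -/
noncomputable def harmonicPart (Pr : E → Measure Ω) (X : ℕ → Ω → Option E) (p : E → E → ℝ≥0)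
    (hu : ∀ x ∈ E, x * u ∈ E) (f : E → ℝ≥0) (x : E) : ℝ≥0 :=
  ((f (shift hu x) : ℝ≥0∞) - greenOp Pr X (opA p hu fun z => (f z : ℝ≥0∞)) x).toNNReal

section Countable

variable [Countable E]

theorem IsMarkovChain.greenOp_opA_le (hX : IsMarkovChain p Pr X)
    (hp : ∀ x y : E, p x y ≤ p (shift hu x) (shift hu y)) (f : harmonicCone p) (x : E) :
    greenOp Pr X (opA p hu fun z => (f.1 z : ℝ≥0∞)) x ≤ f.1 (shift hu x) :=
  hX.greenOp_le (comp_shift_eq hp f) x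

theorem IsMarkovChain.greenOp_opA_ne_top (hX : IsMarkovChain p Pr X)
    (hp : ∀ x y : E, p x y ≤ p (shift hu x) (shift hu y)) (f : harmonicCone p) (x : E) :
    greenOp Pr X (opA p hu fun z => (f.1 z : ℝ≥0∞)) x ≠ ∞ :=
  ne_top_of_le_ne_top ENNReal.coe_ne_top (hX.greenOp_opA_le hp f x)

theorem IsMarkovChain.harmonicPart_add_greenOp (hX : IsMarkovChain p Pr X)
    (hp : ∀ x y : E, p x y ≤ p (shift hu x) (shift hu y)) (f : harmonicCone p) (x : E) :
    (harmonicPart Pr X p hu f x : ℝ≥0∞) + greenOp Pr X (opA p hu fun z => (f.1 z : ℝ≥0∞)) x =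
      f.1 (shift hu x) := by
  rw [harmonicPart, ENNReal.coe_toNNReal (ENNReal.sub_ne_top ENNReal.coe_ne_top)]
  exact tsub_add_cancel_of_le (hX.greenOp_opA_le hp f x)

/-- Subtract G φ = φ + P G φ from f(· ⋆ u) = P[f(· ⋆ u)] + φ; cancellation is legitimate since G φ
is finite. -/
theorem IsMarkovChain.harmonicPart_mem (hX : IsMarkovChain p Pr X)
    (hp : ∀ x y : E, p x y ≤ p (shift hu x) (shift hu y)) (f : harmonicCone p) :
    harmonicPart Pr X p hu f ∈ harmonicCone p := by
  set φ := opA p hu fun z => (f.1 z : ℝ≥0∞)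
  have e : (fun x => (f.1 (shift hu x) : ℝ≥0∞)) =
      (fun x => (harmonicPart Pr X p hu f x : ℝ≥0∞)) + greenOp Pr X φ :=
    funext fun x => (hX.harmonicPart_add_greenOp hp f x).symm
  have h := comp_shift_eq hp f
  have hG : greenOp Pr X φ = φ + transOp p (greenOp Pr X φ) := funext (hX.greenOp_eq_add φ)
  rw [e, transOp_add, add_assoc, add_comm (transOp p (greenOp Pr X φ)), ← hG] at h
  funext x
  exact ((ENNReal.add_left_inj (hX.greenOp_opA_ne_top hp f x)).1 (congrFun h x)).symm

/-- The linear operator on the cone of harmonic functions that maps `f` to the harmonic part of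
`f(· ⋆ u)`. -/
noncomputable def harmonicPartOp (hX : IsMarkovChain p Pr X)
    (hp : ∀ x y : E, p x y ≤ p (shift hu x) (shift hu y)) :
    Module.End ℝ≥0 (harmonicCone p) where
  toFun f := ⟨harmonicPart Pr X p hu f, hX.harmonicPart_mem hp f⟩
  map_add' f g := by
    refine Subtype.ext (funext fun x => ENNReal.coe_injective ?_)
    have h := hX.harmonicPart_add_greenOp hp (f + g) x
    have e : (fun z => ((f + g).1 z : ℝ≥0∞)) =
        (fun z => (f.1 z : ℝ≥0∞)) + fun z => (g.1 z : ℝ≥0∞) := by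
      funext z; simp
    refine (ENNReal.add_left_inj (hX.greenOp_opA_ne_top hp (f + g) x)).1 (h.trans ?_)
    rw [e, opA_add, greenOp_add, Submodule.coe_add, Submodule.coe_add]
    simp only [Pi.add_apply, ENNReal.coe_add]
    rw [← hX.harmonicPart_add_greenOp hp f x, ← hX.harmonicPart_add_greenOp hp g x]
    ring
  map_smul' c f := by
    refine Subtype.ext (funext fun x => ENNReal.coe_injective ?_)
    have h := hX.harmonicPart_add_greenOp hp (c • f) x
    have e : (fun z => ((c • f).1 z : ℝ≥0∞)) = fun z => (c : ℝ≥0∞) * f.1 z := by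
      funext z; simp
    refine (ENNReal.add_left_inj (hX.greenOp_opA_ne_top hp (c • f) x)).1 (h.trans ?_)
    rw [e, opA_const_mul, greenOp_const_mul, Submodule.coe_smul, Submodule.coe_smul]
    simp only [Pi.smul_apply, smul_eq_mul, ENNReal.coe_mul, RingHom.id_apply]
    rw [← hX.harmonicPart_add_greenOp hp f x, mul_add]

theorem harmonicPartOp_add_greenOp (hX : IsMarkovChain p Pr X)
    (hp : ∀ x y : E, p x y ≤ p (shift hu x) (shift hu y)) (f : harmonicCone p) (x : E) :
    ((harmonicPartOp hX hp f).1 x : ℝ≥0∞) + greenOp Pr X (opA p hu fun z => (f.1 z : ℝ≥0∞)) x =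
      f.1 (shift hu x) :=
  hX.harmonicPart_add_greenOp hp f x

/-- Each further translation splits Uⁿ f into Uⁿ⁺¹ f plus a finite potential and shifts the old
remainder; both error terms vanish under Pᵐ. -/
theorem harmonicPartOp_pow_add (hX : IsMarkovChain p Pr X)
    (hp : ∀ x y : E, p x y ≤ p (shift hu x) (shift hu y)) (n : ℕ) (f : harmonicCone p) :
    ∃ g, IsVanishing p g ∧
      ∀ x, (f.1 (shiftPow hu n x) : ℝ≥0∞) = ((harmonicPartOp hX hp ^ n) f).1 x + g x := by
  induction n with
  | zero =>
    refine ⟨0, fun x => ?_, fun x => by simp [shiftPow]⟩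
    have : ∀ n : ℕ, (transOp p)^[n] 0 x = 0 := fun n => by
      rw [Function.iterate_fixed (by funext y; simp [transOp])]
      rfl
    simp only [this]
    exact tendsto_const_nhds
  | succ n ih =>
    obtain ⟨g, hg, h⟩ := ih
    refine ⟨_, (hX.isVanishing_greenOp (hX.greenOp_opA_ne_top hp
      ((harmonicPartOp hX hp ^ n) f))).add (hg.comp_shift hp), fun x => ?_⟩
    rw [shiftPow_shift, h, ← harmonicPartOp_add_greenOp hX hp, pow_succ', Module.End.mul_apply,
      add_assoc]
    rfl

theorem harmonicPartOp_pow_le (hX : IsMarkovChain p Pr X)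
    (hp : ∀ x y : E, p x y ≤ p (shift hu x) (shift hu y)) (n : ℕ) (f : harmonicCone p) (x : E) :
    ((harmonicPartOp hX hp ^ n) f).1 x ≤ f.1 (shiftPow hu n x) := by
  obtain ⟨g, -, h⟩ := harmonicPartOp_pow_add hX hp n f
  rw [← ENNReal.coe_le_coe, h]
  exact le_self_add

/-- A harmonic function below `f(· ⋆ uⁿ)` is below its harmonic part. -/
theorem le_harmonicPartOp_pow (hX : IsMarkovChain p Pr X)
    (hp : ∀ x y : E, p x y ≤ p (shift hu x) (shift hu y)) (n : ℕ) (f k : harmonicCone p)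
    (hk : ∀ x, k.1 x ≤ f.1 (shiftPow hu n x)) (x : E) :
    k.1 x ≤ ((harmonicPartOp hX hp ^ n) f).1 x := by
  obtain ⟨g, hg, h⟩ := harmonicPartOp_pow_add hX hp n f
  -- Applying Pᵐ fixes both harmonic functions and kills g in the limit.
  have key : ∀ m : ℕ, (k.1 x : ℝ≥0∞) ≤
      ((harmonicPartOp hX hp ^ n) f).1 x + (transOp p)^[m] g x := by
    intro m
    have hle : (fun x => (k.1 x : ℝ≥0∞)) ≤
        (fun x => (((harmonicPartOp hX hp ^ n) f).1 x : ℝ≥0∞)) + g := fun x => by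
      rw [Pi.add_apply, ← h]
      exact ENNReal.coe_le_coe.2 (hk x)
    have := (transOp_mono p).iterate m hle x
    rwa [iterate_transOp_add, iterate_transOp_harmonic, iterate_transOp_harmonic] at this
  have := ge_of_tendsto' ((hg x).const_add _) key
  rw [add_zero] at this
  exact ENNReal.coe_le_coe.1 this

end Countable

/-! ### Subexponential bounds from slow variation -/

theorem le_of_abs_log_lt {q : ℝ≥0∞} (h0 : 0 < q) (h1 : q ≤ 1) {n : ℕ} (hn : 0 < n) {a : ℝ≥0}
    (ha : 0 < a) (h : dist 0 (1 / (n : ℝ) * Real.log q.toReal) < -Real.log a) :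
    ((a ^ n : ℝ≥0) : ℝ≥0∞) ≤ q := by
  have hq : q ≠ ∞ := ne_top_of_le_ne_top ENNReal.one_ne_top h1
  have hq0 : 0 < q.toReal := ENNReal.toReal_pos h0.ne' hq
  have hn' : (0 : ℝ) < n := Nat.cast_pos.2 hn
  rw [Real.dist_eq, zero_sub, abs_neg] at h
  have h2 := (abs_lt.1 h).1
  rw [neg_neg, one_div, ← div_eq_inv_mul, lt_div_iff₀ hn'] at h2
  have h3 : (a : ℝ) ^ n ≤ q.toReal := by
    rw [← Real.log_le_log_iff (by positivity) hq0, Real.log_pow]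
    linarith
  rw [← ENNReal.ofReal_toReal hq, ← ENNReal.ofReal_coe_nnreal]
  exact ENNReal.ofReal_le_ofReal (by exact_mod_cast h3)

theorem IsSlowlyVarying.eventually_le (hslow : IsSlowlyVarying Pr X hu)
    (hpr : ∀ x, IsProbabilityMeasure (Pr x)) {a : ℝ≥0} (ha : 0 < a) (ha1 : a < 1) :
    ∀ᶠ n : ℕ in atTop, ∀ x : E, ((a ^ n : ℝ≥0) : ℝ≥0∞) ≤ hitting Pr X x (shiftPow hu n x) ∧
      ((a ^ n : ℝ≥0) : ℝ≥0∞) ≤ hitting Pr X (shiftPow hu n x) x := by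
  obtain ⟨hpos, h1, h2⟩ := hslow
  have hε : 0 < -Real.log a :=
    neg_pos.2 (Real.log_neg (by exact_mod_cast ha) (by exact_mod_cast ha1))
  filter_upwards [hpos, Metric.tendstoUniformly_iff.1 h1 _ hε,
    Metric.tendstoUniformly_iff.1 h2 _ hε, eventually_gt_atTop 0] with n h0 h1 h2 hn x
  exact ⟨le_of_abs_log_lt (h0 x).1 prob_le_one hn ha (h1 x),
    le_of_abs_log_lt (h0 x).2 prob_le_one hn ha (h2 x)⟩

theorem harmonicPartOp_eq [Countable E] (hX : IsMarkovChain p Pr X)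
    (hp : ∀ x y : E, p x y ≤ p (shift hu x) (shift hu y)) (hslow : IsSlowlyVarying Pr X hu)
    (f : harmonicCone p) : harmonicPartOp hX hp f = f := by
  refine apply_eq_of_subexponential (harmonicCone_sub p) _ (fun a b ha ha1 hb => ?_) f
  have hb0 : 0 < b := zero_lt_one.trans hb
  -- Returning from x ⋆ uⁿ to x gives the lower bound with rate a; going from x to x ⋆ uⁿ gives the
  -- upper bound with rate b⁻¹. The threshold for n does not depend on f.
  filter_upwards [hslow.eventually_le hX.isProbabilityMeasure ha ha1,
    hslow.eventually_le hX.isProbabilityMeasure (inv_pos.2 hb0) (inv_lt_one_of_one_lt₀ hb)]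
    with n hna hnb f
  constructor
  · refine le_harmonicPartOp_pow hX hp n f (a ^ n • f) fun x => ?_
    have := (mul_le_mul_left (hna x).2 _).trans (hX.hitting_mul_le f.2 (shiftPow hu n x) x)
    exact_mod_cast this
  · intro x
    refine (harmonicPartOp_pow_le hX hp n f x).trans ?_
    have := (mul_le_mul_left (hnb x).1 _).trans (hX.hitting_mul_le f.2 x (shiftPow hu n x))
    have h2 : b⁻¹ ^ n * f.1 (shiftPow hu n x) ≤ f.1 x := by exact_mod_cast this
    rw [inv_pow, inv_mul_le_iff₀ (pow_pos hb0 n)] at h2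
    exact h2

end Translate

end KilledWalk

theorem theorem1 {𝓔 : Type*} [Group 𝓔] (E : Set 𝓔) (hE : E.Countable)
    (p : E → E → ℝ≥0) (hsub : KilledWalk.IsSubstochastic p)
    {Ω : Type*} [MeasurableSpace Ω] (Pr : E → Measure Ω) (X : ℕ → Ω → Option E)
    (hX : KilledWalk.IsMarkovChain p Pr X)
    (hirr : KilledWalk.IsIrreducible Pr X) (htrans : KilledWalk.IsTransient Pr X)
    (u : 𝓔) (huE : u ∈ E) (hu : ∀ x ∈ E, x * u ∈ E)
    (hp : ∀ x y : E, p x y ≤ p (KilledWalk.shift hu x) (KilledWalk.shift hu y))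
    (hslow : KilledWalk.IsSlowlyVarying Pr X hu)
    (h : E → ℝ≥0) (hh : KilledWalk.IsHarmonic p h) (y : E) :
    (h (KilledWalk.shift hu y) : ℝ≥0∞) =
      h y + KilledWalk.greenOp Pr X (KilledWalk.opA p hu (fun z => (h z : ℝ≥0∞))) y := by
  have : Countable E := hE.to_subtype
  have hmem : h ∈ KilledWalk.harmonicCone p := funext hh.2
  have e := KilledWalk.harmonicPartOp_add_greenOp hX hp ⟨h, hmem⟩ y
  rw [KilledWalk.harmonicPartOp_eq hX hp hslow] at e
  exact e.symm
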